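/- Let $n\ge 4$ and let $(M,g)$ be an $n$-dimensional generalized Robertson--Walker (GRW) spacetime: a smooth Lorentzian manifold of signature $(+,\dots,+,-)$ that is isometric to $I\times N$ with the metric $-dt^2+q(t)^2h$, where $I\subseteq\mathbb R$ is an open interval, $q>0$ is a smooth function on $I$ and $(N,h)$ is an $(n-1)$-dimensional Riemannian manifold. Let $\rho=\partial_t$ be its unit timelike vector field, $\eta=g(\rho,\cdot)$, let $\psi=q'(t)/q(t)$ (so that $\nabla_U\rho=\psi\,(U+\eta(U)\rho)$ for all $U$), and put $\mu=\rho\psi+\psi^2$. Write $S$ for the Ricci tensor and $r$ for the scalar curvature of $g$. Suppose that $g$ is a gradient $(m,\tau)$-quasi Einstein soliton, i.e. there are a smooth function $f$ on $M$ and real constants $m>0$, $\lambda_1$, $\tau$ with $$\operatorname{Hess} f+S-\frac1m\,df\otimes df=\beta_1\,g,\qquad \beta_1=\lambda_1+\tau r .$$ If $\beta_1=(n-1)\mu$ is a non-zero constant and $\rho f$ is constant, then $(M,g)$ is a perfect-fluid spacetime with velocity field $\rho$: the Ricci tensor vanishes nowhere, and there are smooth functions $a_1,b_1$ on $M$ (possibly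 $b_1=0$) such that $$S=a_1\,g+b_1\,\eta\otimes\eta .$$ -/

import Mathlib

open scoped Manifold ContDiff Bundle

noncomputable section

/-! ### Riemannian curvature in local coordinates

`G : ℝⁿ → Matrix` is the matrix of components `g_{ij}` of a metric in a coordinate system. -/

namespace Coord

variable {n : ℕ}

/-- The partial derivative `∂u/∂xⁱ` at `y`. -/
def pd (i : Fin n) (u : EuclideanSpace ℝ (Fin n) → ℝ) (y : EuclideanSpace ℝ (Fin n)) : ℝ :=
  fderiv ℝ u y (EuclideanSpace.single i 1)

/-- The Christoffel symbol
`Γᵏᵢⱼ = ½ gᵏˡ (∂ᵢ gⱼₗ + ∂ⱼ gᵢₗ - ∂ₗ gᵢⱼ)` of the Levi-Civita connection. -/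
def christoffel (G : EuclideanSpace ℝ (Fin n) → Matrix (Fin n) (Fin n) ℝ)
    (k i j : Fin n) (y : EuclideanSpace ℝ (Fin n)) : ℝ :=
  (1 / 2) * ∑ l, (G y)⁻¹ k l *
    (pd i (fun z => G z j l) y + pd j (fun z => G z i l) y - pd l (fun z => G z i j) y)

/-- The Ricci tensor
`Sᵢⱼ = ∂ₖΓᵏᵢⱼ - ∂ⱼΓᵏᵢₖ + Γᵏₖₗ Γˡᵢⱼ - Γᵏⱼₗ Γˡᵢₖ` (positive on round spheres). -/
def ricci (G : EuclideanSpace ℝ (Fin n) → Matrix (Fin n) (Fin n) ℝ)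
    (i j : Fin n) (y : EuclideanSpace ℝ (Fin n)) : ℝ :=
  ∑ k, pd k (christoffel G k i j) y - ∑ k, pd j (christoffel G k i k) y
    + ∑ k, ∑ l, christoffel G k k l y * christoffel G l i j y
    - ∑ k, ∑ l, christoffel G k j l y * christoffel G l i k y

/-- The scalar curvature `r = gⁱʲ Sᵢⱼ`. -/
def scalar (G : EuclideanSpace ℝ (Fin n) → Matrix (Fin n) (Fin n) ℝ)
    (y : EuclideanSpace ℝ (Fin n)) : ℝ :=
  ∑ i, ∑ j, (G y)⁻¹ i j * ricci G i j y

/-- The Hessian `(Hess u)ᵢⱼ = ∂ᵢ∂ⱼ u - Γᵏᵢⱼ ∂ₖ u`. -/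
def hess (G : EuclideanSpace ℝ (Fin n) → Matrix (Fin n) (Fin n) ℝ)
    (u : EuclideanSpace ℝ (Fin n) → ℝ) (i j : Fin n) (y : EuclideanSpace ℝ (Fin n)) : ℝ :=
  pd i (pd j u) y - ∑ k, christoffel G k i j y * pd k u y

end Coord

/-- The derivative `v u = du(v)` of a function `u : M → ℝ` in the direction of a tangent vector. -/
def dirDeriv {n : ℕ} {M : Type*} [TopologicalSpace M] [ChartedSpace (EuclideanSpace ℝ (Fin n)) M]
    (u : M → ℝ) (x : M) (v : TangentSpace (𝓡 n) x) : ℝ :=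
  mfderiv (𝓡 n) 𝓘(ℝ, ℝ) u x v

/-! ### Lorentzian metrics -/

/-- A smooth Lorentzian metric, of signature `(+, …, +, -)`, on an `n`-dimensional manifold. -/
structure LorentzianMetric (n : ℕ) (M : Type*) [TopologicalSpace M]
    [ChartedSpace (EuclideanSpace ℝ (Fin n)) M] [IsManifold (𝓡 n) ∞ M] where
  /-- The scalar product on the tangent space at `x`. -/
  inner (x : M) : TangentSpace (𝓡 n) x →L[ℝ] TangentSpace (𝓡 n) x →L[ℝ] ℝ
  symm (x : M) (v w : TangentSpace (𝓡 n) x) : inner x v w = inner x w v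
  /-- There is a timelike vector, on whose orthogonal complement the scalar product is
  positive definite. -/
  signature (x : M) : ∃ v : TangentSpace (𝓡 n) x, inner x v v < 0 ∧
    ∀ w : TangentSpace (𝓡 n) x, inner x v w = 0 → w ≠ 0 → 0 < inner x w w
  contMDiff : ContMDiff (𝓡 n)
    ((𝓡 n).prod 𝓘(ℝ, EuclideanSpace ℝ (Fin n) →L[ℝ] EuclideanSpace ℝ (Fin n) →L[ℝ] ℝ)) ∞
    (fun x ↦ Bundle.TotalSpace.mk'
      (EuclideanSpace ℝ (Fin n) →L[ℝ] EuclideanSpace ℝ (Fin n) →L[ℝ] ℝ)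
      (E := fun x : M ↦ TangentSpace (𝓡 n) x →L[ℝ] TangentSpace (𝓡 n) x →L[ℝ] ℝ) x (inner x))

namespace LorentzianMetric

variable {n : ℕ} {M : Type*} [TopologicalSpace M]
  [ChartedSpace (EuclideanSpace ℝ (Fin n)) M] [IsManifold (𝓡 n) ∞ M]

/-- The coordinate vector `∂/∂xⁱ` of the chart `e`, at the point with coordinates `y`. -/
def coordVec (e : OpenPartialHomeomorph M (EuclideanSpace ℝ (Fin n))) (i : Fin n)
    (y : EuclideanSpace ℝ (Fin n)) : TangentSpace (𝓡 n) (e.symm y) :=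
  mfderiv (𝓡 n) (𝓡 n) e.symm y (EuclideanSpace.single i (1 : ℝ))

/-- The components `gᵢⱼ` of the metric in the chart `e`, as functions of the coordinates. -/
def comp (g : LorentzianMetric n M) (e : OpenPartialHomeomorph M (EuclideanSpace ℝ (Fin n)))
    (y : EuclideanSpace ℝ (Fin n)) : Matrix (Fin n) (Fin n) ℝ :=
  Matrix.of fun i j => g.inner (e.symm y) (coordVec e i y) (coordVec e j y)

/-- The component `Sᵢⱼ` of the Ricci tensor in the chart `e`. -/
def ricci (g : LorentzianMetric n M) (e : OpenPartialHomeomorph M (EuclideanSpace ℝ (Fin n)))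
    (i j : Fin n) (y : EuclideanSpace ℝ (Fin n)) : ℝ :=
  Coord.ricci (g.comp e) i j y

/-- The component `(Hess f)ᵢⱼ` of the Hessian of `f` in the chart `e`. -/
def hess (g : LorentzianMetric n M) (e : OpenPartialHomeomorph M (EuclideanSpace ℝ (Fin n)))
    (f : M → ℝ) (i j : Fin n) (y : EuclideanSpace ℝ (Fin n)) : ℝ :=
  Coord.hess (g.comp e) (f ∘ e.symm) i j y

/-- The scalar curvature `r` as a function on `M`. It does not depend on the coordinates used;
they are those of the preferred chart at `x`. -/
def scalarCurvature (g : LorentzianMetric n M) (x : M) : ℝ :=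
  Coord.scalar (g.comp (chartAt (EuclideanSpace ℝ (Fin n)) x))
    (chartAt (EuclideanSpace ℝ (Fin n)) x x)

/-- `g` is a gradient `(m, τ)`-quasi Einstein soliton with potential function `f`:
`Hess f + S - (1/m) df ⊗ df = (lam + τ r) g`, as an equation between the components of tensors in
every chart of the (maximal) smooth atlas. -/
structure IsQuasiEinsteinSoliton (g : LorentzianMetric n M) (f : M → ℝ) (m lam τ : ℝ) : Prop where
  pos : 0 < m
  smooth : ContMDiff (𝓡 n) 𝓘(ℝ, ℝ) ∞ f
  eqn : ∀ e ∈ IsManifold.maximalAtlas (𝓡 n) ∞ M, ∀ y ∈ e.target, ∀ i j : Fin n,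
    g.hess e f i j y + g.ricci e i j y
      - (1 / m) * (Coord.pd i (f ∘ e.symm) y * Coord.pd j (f ∘ e.symm) y)
      = (lam + τ * g.scalarCurvature (e.symm y)) * g.comp e y i j

/-- `g` is a perfect fluid metric with velocity field `u`: the vector field `u` is unit timelike,
the Ricci tensor `S` vanishes nowhere, and `S = a g + b η ⊗ η` for scalar fields `a`, `b`, where
`η = g(u, ·)`. The tensor equation is between components in every chart of the smooth atlas. -/
structure IsPerfectFluid (g : LorentzianMetric n M) (u : (x : M) → TangentSpace (𝓡 n) x) :
    Prop where
  smooth : ContMDiff (𝓡 n) (𝓡 n).tangent ∞ (fun x ↦ (⟨x, u x⟩ : TangentBundle (𝓡 n) M))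
  unit : ∀ x, g.inner x (u x) (u x) = -1
  ricci_ne_zero : ∀ e ∈ IsManifold.maximalAtlas (𝓡 n) ∞ M, ∀ y ∈ e.target,
    ∃ i j : Fin n, g.ricci e i j y ≠ 0
  eqn : ∃ a b : M → ℝ, ContMDiff (𝓡 n) 𝓘(ℝ, ℝ) ∞ a ∧ ContMDiff (𝓡 n) 𝓘(ℝ, ℝ) ∞ b ∧
    ∀ e ∈ IsManifold.maximalAtlas (𝓡 n) ∞ M, ∀ y ∈ e.target, ∀ i j : Fin n,
      g.ricci e i j y = a (e.symm y) * g.comp e y i j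
        + b (e.symm y) * (g.inner (e.symm y) (u (e.symm y)) (coordVec e i y)
          * g.inner (e.symm y) (u (e.symm y)) (coordVec e j y))

end LorentzianMetric

/-! ### Generalized Robertson-Walker spacetimes -/

/-- A presentation of the `(k + 1)`-dimensional Lorentzian manifold `(M, g)` as a generalized
Robertson-Walker spacetime `-I ×_{q²} N`: an isometry of `(M, g)` onto `I × N` with the metric
`-dt² + q(t)² h`, where `I` is an open interval, `q > 0` a smooth function on `I` and `h` a
Riemannian metric on the `k`-dimensional manifold `N`. -/
structure GRWPresentation {k : ℕ} {M : Type*} [TopologicalSpace M]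
    [ChartedSpace (EuclideanSpace ℝ (Fin (k + 1))) M] [IsManifold (𝓡 (k + 1)) ∞ M]
    (g : LorentzianMetric (k + 1) M)
    (N : Type*) [TopologicalSpace N] [ChartedSpace (EuclideanSpace ℝ (Fin k)) N]
    [IsManifold (𝓡 k) ∞ N] where
  /-- The interval of time. -/
  I : TopologicalSpace.Opens ℝ
  ordConnected : (I : Set ℝ).OrdConnected
  /-- The warping function. -/
  q : ℝ → ℝ
  q_smooth : ContDiffOn ℝ ∞ q I
  q_pos : ∀ t ∈ I, 0 < q t
  /-- The Riemannian metric of the fibre. -/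
  h : Bundle.ContMDiffRiemannianMetric (𝓡 k) ∞ (EuclideanSpace ℝ (Fin k))
    (fun p : N ↦ TangentSpace (𝓡 k) p)
  /-- The isometry. -/
  Φ : M ≃ₘ^∞⟮𝓡 (k + 1), 𝓘(ℝ, ℝ).prod (𝓡 k)⟯ (I × N)
  isometry : ∀ (x : M) (v w : TangentSpace (𝓡 (k + 1)) x),
    g.inner x v w =
      -(dirDeriv (fun z ↦ ((Φ z).1 : ℝ)) x v * dirDeriv (fun z ↦ ((Φ z).1 : ℝ)) x w)
        + q (Φ x).1 ^ 2 * h.inner (Φ x).2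
          (mfderiv (𝓡 (k + 1)) (𝓡 k) (fun z ↦ (Φ z).2) x v)
          (mfderiv (𝓡 (k + 1)) (𝓡 k) (fun z ↦ (Φ z).2) x w)

namespace GRWPresentation

variable {k : ℕ} {M : Type*} [TopologicalSpace M]
  [ChartedSpace (EuclideanSpace ℝ (Fin (k + 1))) M] [IsManifold (𝓡 (k + 1)) ∞ M]
  {g : LorentzianMetric (k + 1) M}
  {N : Type*} [TopologicalSpace N] [ChartedSpace (EuclideanSpace ℝ (Fin k)) N]
  [IsManifold (𝓡 k) ∞ N]

/-- The vector field `∂/∂t = (1, 0)` on `I × N`. -/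
def timeField (P : GRWPresentation g N) (p : P.I × N) :
    TangentSpace (𝓘(ℝ, ℝ).prod (𝓡 k)) p :=
  ((1 : ℝ), (0 : EuclideanSpace ℝ (Fin k)))

/-- The unit timelike vector field `ρ = ∂/∂t` on `M`, pulled back along the isometry. -/
def rho (P : GRWPresentation g N) : (x : M) → TangentSpace (𝓡 (k + 1)) x :=
  VectorField.mpullback (𝓡 (k + 1)) (𝓘(ℝ, ℝ).prod (𝓡 k)) P.Φ P.timeField

/-- The derivative `ρ u` of a function `u` in the direction of `ρ`. -/
def rhoDeriv (P : GRWPresentation g N) (u : M → ℝ) (x : M) : ℝ :=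
  dirDeriv u x (P.rho x)

/-- The scalar `ψ = (ρ q) / q = q'(t) / q(t)`, for which `∇_U ρ = ψ (U + η(U) ρ)`. -/
def psi (P : GRWPresentation g N) (x : M) : ℝ :=
  P.rhoDeriv (fun z ↦ P.q (P.Φ z).1) x / P.q (P.Φ x).1

/-- The scalar `μ = ρ ψ + ψ²`. -/
def mu (P : GRWPresentation g N) (x : M) : ℝ :=
  P.rhoDeriv P.psi x + P.psi x ^ 2

end GRWPresentation

end

/-! The hypotheses force the potential $f$ to be locally constant, so the soliton equation collapses
to $S=\beta g$: the spacetime is Einstein, $a_1=\beta$ and $b_1=0$, and $S$ vanishes nowhere because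
$\beta\ne0$.

Everything is read off in charts made of the time $t$ and a chart of $N$, where $g=-dt^2+q^2H$ and
$\rho=\partial_t$. Only two pieces of the Ricci tensor are needed: $S_{tt}=-(n-1)\mu=-\beta$
(`ricci_zero_zero`) and $S_{at}=0$ (`ricci_succ_zero`). With $\rho f=c$ constant, the $(t,t)$
component of the soliton equation reads $-\beta-c^2/m=-\beta$, so $c=0$. The mixed components then
read $\psi\,\partial_a f=0$. If $\partial_a f\neq0$ at a point, it is non-zero nearby, so $\psi=0$
there, hence $\mu=\rho\psi+\psi^2=0$, against $\beta\neq0$. This is `pd_potential_eq_zero`;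
`isWarped_productChart` and `rho_productChart_symm` connect the manifold with the coordinate
computation. -/

noncomputable section

/-! ### Partial derivatives of functions of time, of space, and of their products. -/

namespace Coord

variable {n k : ℕ}

lemma pd_congr {i : Fin n} {u v : EuclideanSpace ℝ (Fin n) → ℝ} {U : Set (EuclideanSpace ℝ (Fin n))}
    (hU : IsOpen U) (h : ∀ z ∈ U, u z = v z) {y : EuclideanSpace ℝ (Fin n)} (hy : y ∈ U) :
    pd i u y = pd i v y := by
  have : u =ᶠ[nhds y] v := Filter.eventuallyEq_of_mem (hU.mem_nhds hy) h
  rw [pd, pd, this.fderiv_eq]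

lemma pd_const (i : Fin n) (c : ℝ) (y : EuclideanSpace ℝ (Fin n)) :
    pd i (fun _ => c) y = 0 := by
  simp [pd]

/-- The spatial part of a coordinate vector, as a continuous linear map. -/
def spatial (k : ℕ) : EuclideanSpace ℝ (Fin (k + 1)) →L[ℝ] EuclideanSpace ℝ (Fin k) :=
  (EuclideanSpace.equiv (Fin k) ℝ).symm.toContinuousLinearMap ∘L
    ContinuousLinearMap.pi fun a => EuclideanSpace.proj a.succ

@[simp] lemma spatial_apply (y : EuclideanSpace ℝ (Fin (k + 1))) (a : Fin k) :
    spatial k y a = y a.succ := rfl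

lemma spatial_single_zero :
    spatial k (EuclideanSpace.single 0 1) = 0 := by
  ext a; simp

lemma spatial_single_succ (a : Fin k) :
    spatial k (EuclideanSpace.single a.succ 1) = EuclideanSpace.single a 1 := by
  ext b; simp

lemma hasFDerivAt_time {u : ℝ → ℝ} {u' : ℝ} {y : EuclideanSpace ℝ (Fin (k + 1))}
    (hu : HasDerivAt u u' (y 0)) :
    HasFDerivAt (fun z : EuclideanSpace ℝ (Fin (k + 1)) => u (z 0))
      (u' • (EuclideanSpace.proj 0 : EuclideanSpace ℝ (Fin (k + 1)) →L[ℝ] ℝ)) y :=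
  hu.comp_hasFDerivAt y (EuclideanSpace.proj 0 : EuclideanSpace ℝ (Fin (k + 1)) →L[ℝ] ℝ).hasFDerivAt

lemma pd_zero_time {u : ℝ → ℝ} {u' : ℝ} {y : EuclideanSpace ℝ (Fin (k + 1))}
    (hu : HasDerivAt u u' (y 0)) : pd 0 (fun z => u (z 0)) y = u' := by
  simp [pd, (hasFDerivAt_time hu).fderiv]

lemma pd_succ_time {u : ℝ → ℝ} {u' : ℝ} {y : EuclideanSpace ℝ (Fin (k + 1))} (a : Fin k)
    (hu : HasDerivAt u u' (y 0)) : pd a.succ (fun z => u (z 0)) y = 0 := by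
  simp [pd, (hasFDerivAt_time hu).fderiv]

/-- No regularity of `w` is required: if the composite is not differentiable, `fderiv` is $0$ by
convention. This allows `w` to be a Christoffel symbol of $H$, whose differentiability `IsWarped`
does not provide. -/
lemma pd_zero_comp_spatial (w : EuclideanSpace ℝ (Fin k) → ℝ) (y : EuclideanSpace ℝ (Fin (k + 1))) :
    pd 0 (fun z => w (spatial k z)) y = 0 := by
  by_cases h : DifferentiableAt ℝ (fun z => w (spatial k z)) y
  · rw [pd, ← h.lineDeriv_eq_fderiv, lineDeriv]
    simp [spatial_single_zero]
  · simp [pd, fderiv_zero_of_not_differentiableAt h]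

lemma hasFDerivAt_warped {u : ℝ → ℝ} {u' : ℝ} {w : EuclideanSpace ℝ (Fin k) → ℝ}
    {y : EuclideanSpace ℝ (Fin (k + 1))} (hu : HasDerivAt u u' (y 0))
    (hw : DifferentiableAt ℝ w (spatial k y)) :
    HasFDerivAt (fun z => u (z 0) * w (spatial k z))
      (u (y 0) • (fderiv ℝ w (spatial k y) ∘L spatial k) + w (spatial k y) •
        (u' • (EuclideanSpace.proj 0 : EuclideanSpace ℝ (Fin (k + 1)) →L[ℝ] ℝ))) y :=
  (hasFDerivAt_time hu).mul (hw.hasFDerivAt.comp y (spatial k).hasFDerivAt)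

lemma pd_zero_warped {u : ℝ → ℝ} {u' : ℝ} {w : EuclideanSpace ℝ (Fin k) → ℝ}
    {y : EuclideanSpace ℝ (Fin (k + 1))} (hu : HasDerivAt u u' (y 0))
    (hw : DifferentiableAt ℝ w (spatial k y)) :
    pd 0 (fun z => u (z 0) * w (spatial k z)) y = u' * w (spatial k y) := by
  simp [pd, (hasFDerivAt_warped hu hw).fderiv, spatial_single_zero, mul_comm]

lemma pd_succ_warped {u : ℝ → ℝ} {u' : ℝ} {w : EuclideanSpace ℝ (Fin k) → ℝ}
    {y : EuclideanSpace ℝ (Fin (k + 1))} (a : Fin k) (hu : HasDerivAt u u' (y 0))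
    (hw : DifferentiableAt ℝ w (spatial k y)) :
    pd a.succ (fun z => u (z 0) * w (spatial k z)) y = u (y 0) * pd a w (spatial k y) := by
  simp [pd, (hasFDerivAt_warped hu hw).fderiv, spatial_single_succ]

/-- `G` is, on the open set `U`, the matrix of the warped product metric `-dt² + q(t)² H`, where
`t` is the coordinate with index `0`. -/
structure IsWarped (G : EuclideanSpace ℝ (Fin (k + 1)) → Matrix (Fin (k + 1)) (Fin (k + 1)) ℝ)
    (U : Set (EuclideanSpace ℝ (Fin (k + 1)))) (q : ℝ → ℝ)
    (H : EuclideanSpace ℝ (Fin k) → Matrix (Fin k) (Fin k) ℝ) : Prop where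
  isOpen : IsOpen U
  q_ne_zero : ∀ y ∈ U, q (y 0) ≠ 0
  q_diff : ∀ y ∈ U, DifferentiableAt ℝ q (y 0)
  H_symm : ∀ y ∈ U, ∀ a b, H (spatial k y) a b = H (spatial k y) b a
  H_det : ∀ y ∈ U, IsUnit (H (spatial k y)).det
  H_diff : ∀ y ∈ U, ∀ a b, DifferentiableAt ℝ (fun p => H p a b) (spatial k y)
  zero_zero : ∀ y ∈ U, G y 0 0 = -1
  zero_succ : ∀ y ∈ U, ∀ a : Fin k, G y 0 a.succ = 0
  succ_zero : ∀ y ∈ U, ∀ a : Fin k, G y a.succ 0 = 0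
  succ_succ : ∀ y ∈ U, ∀ a b : Fin k, G y a.succ b.succ = q (y 0) ^ 2 * H (spatial k y) a b

/-! ### Christoffel symbols and Ricci components of $-dt^2+q^2H$. -/

namespace IsWarped

variable {G : EuclideanSpace ℝ (Fin (k + 1)) → Matrix (Fin (k + 1)) (Fin (k + 1)) ℝ}
  {U : Set (EuclideanSpace ℝ (Fin (k + 1)))} {q : ℝ → ℝ}
  {H : EuclideanSpace ℝ (Fin k) → Matrix (Fin k) (Fin k) ℝ} {y : EuclideanSpace ℝ (Fin (k + 1))}

/-- The inverse matrix of a warped product metric. -/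
lemma inv_eq (hG : IsWarped G U q H) (hy : y ∈ U) :
    (G y)⁻¹ = Matrix.of (Fin.cons (Fin.cons (-1) fun _ => 0)
      fun a => Fin.cons 0 fun b => (q (y 0) ^ 2)⁻¹ * (H (spatial k y))⁻¹ a b) := by
  have hq := hG.q_ne_zero y hy
  apply Matrix.inv_eq_right_inv
  ext i j
  rw [Matrix.mul_apply, Fin.sum_univ_succ]
  refine Fin.cases ?_ (fun a => ?_) i <;> refine Fin.cases ?_ (fun b => ?_) j
  · simp [hG.zero_zero y hy, hG.zero_succ y hy]
  · simp [hG.zero_zero y hy, hG.zero_succ y hy, (Fin.succ_ne_zero b).symm]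
  · simp [hG.succ_zero y hy]
  · have h := congrFun (congrFun (Matrix.mul_nonsing_inv _ (hG.H_det y hy)) a) b
    rw [Matrix.mul_apply] at h
    simp only [Matrix.of_apply, Fin.cons_succ, Fin.cons_zero, hG.succ_zero y hy,
      hG.succ_succ y hy, zero_mul, zero_add]
    rw [show (1 : Matrix (Fin (k + 1)) (Fin (k + 1)) ℝ) a.succ b.succ =
      (1 : Matrix (Fin k) (Fin k) ℝ) a b by simp [Matrix.one_apply], ← h]
    refine Finset.sum_congr rfl fun c _ => ?_
    field_simp

lemma inv_zero_succ (hG : IsWarped G U q H) (hy : y ∈ U) (a : Fin k) :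
    (G y)⁻¹ 0 a.succ = 0 := by
  simp [hG.inv_eq hy]

lemma inv_succ_zero (hG : IsWarped G U q H) (hy : y ∈ U) (a : Fin k) :
    (G y)⁻¹ a.succ 0 = 0 := by
  simp [hG.inv_eq hy]

lemma inv_succ_succ (hG : IsWarped G U q H) (hy : y ∈ U) (a b : Fin k) :
    (G y)⁻¹ a.succ b.succ = (q (y 0) ^ 2)⁻¹ * (H (spatial k y))⁻¹ a b := by
  simp [hG.inv_eq hy]

lemma pd_zero_zero (hG : IsWarped G U q H) (hy : y ∈ U) (i : Fin (k + 1)) :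
    pd i (fun z => G z 0 0) y = 0 := by
  rw [pd_congr hG.isOpen hG.zero_zero hy, pd_const]

lemma pd_zero_succ (hG : IsWarped G U q H) (hy : y ∈ U) (i : Fin (k + 1)) (a : Fin k) :
    pd i (fun z => G z 0 a.succ) y = 0 := by
  rw [pd_congr hG.isOpen (fun z hz => hG.zero_succ z hz a) hy, pd_const]

lemma pd_succ_zero (hG : IsWarped G U q H) (hy : y ∈ U) (i : Fin (k + 1)) (a : Fin k) :
    pd i (fun z => G z a.succ 0) y = 0 := by
  rw [pd_congr hG.isOpen (fun z hz => hG.succ_zero z hz a) hy, pd_const]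

lemma hasDerivAt_sq (hG : IsWarped G U q H) (hy : y ∈ U) :
    HasDerivAt (fun t => q t ^ 2) (2 * q (y 0) * deriv q (y 0)) (y 0) := by
  simpa using (hG.q_diff y hy).hasDerivAt.fun_pow 2

lemma pd_zero_succ_succ (hG : IsWarped G U q H) (hy : y ∈ U) (a b : Fin k) :
    pd 0 (fun z => G z a.succ b.succ) y =
      2 * q (y 0) * deriv q (y 0) * H (spatial k y) a b := by
  rw [pd_congr hG.isOpen (fun z hz => hG.succ_succ z hz a b) hy]
  exact pd_zero_warped (hG.hasDerivAt_sq hy) (hG.H_diff y hy a b)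

lemma pd_succ_succ_succ (hG : IsWarped G U q H) (hy : y ∈ U) (a b c : Fin k) :
    pd c.succ (fun z => G z a.succ b.succ) y =
      q (y 0) ^ 2 * pd c (fun p => H p a b) (spatial k y) := by
  rw [pd_congr hG.isOpen (fun z hz => hG.succ_succ z hz a b) hy]
  exact pd_succ_warped c (hG.hasDerivAt_sq hy) (hG.H_diff y hy a b)

lemma christoffel_zero_zero (hG : IsWarped G U q H) (hy : y ∈ U) (i : Fin (k + 1)) :
    christoffel G i 0 0 y = 0 := by
  rw [christoffel, Fin.sum_univ_succ]
  simp [hG.pd_zero_zero hy, hG.pd_zero_succ hy]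

lemma christoffel_symm (hG : IsWarped G U q H) (hy : y ∈ U) (l i j : Fin (k + 1)) :
    christoffel G l i j y = christoffel G l j i y := by
  have h : ∀ z ∈ U, G z i j = G z j i := fun z hz => by
    refine Fin.cases ?_ (fun a => ?_) i <;> refine Fin.cases ?_ (fun b => ?_) j
    · rfl
    · rw [hG.zero_succ z hz, hG.succ_zero z hz]
    · rw [hG.zero_succ z hz, hG.succ_zero z hz]
    · rw [hG.succ_succ z hz, hG.succ_succ z hz, hG.H_symm z hz]
  simp only [christoffel, pd_congr hG.isOpen h hy]
  congr 1
  refine Finset.sum_congr rfl fun _ _ => ?_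
  ring

lemma christoffel_zero_zero_succ (hG : IsWarped G U q H) (hy : y ∈ U) (a : Fin k) :
    christoffel G 0 0 a.succ y = 0 := by
  rw [christoffel, Fin.sum_univ_succ]
  simp [hG.pd_zero_zero hy, hG.pd_succ_zero hy, hG.inv_zero_succ hy, hG.pd_zero_succ hy]

/-- Only $\tfrac12 g^{bc}\partial_t g_{ac}=\tfrac12 q^{-2}H^{bc}\cdot 2qq'H_{ac}$ survives, and
$H^{-1}H=1$. -/
lemma christoffel_succ_zero_succ (hG : IsWarped G U q H) (hy : y ∈ U) (a b : Fin k) :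
    christoffel G b.succ 0 a.succ y = if b = a then deriv q (y 0) / q (y 0) else 0 := by
  have hq := hG.q_ne_zero y hy
  have h := congrFun (congrFun (Matrix.nonsing_inv_mul _ (hG.H_det y hy)) b) a
  rw [Matrix.mul_apply, Matrix.one_apply] at h
  rw [christoffel, Fin.sum_univ_succ]
  simp only [hG.inv_succ_zero hy, hG.inv_succ_succ hy, hG.pd_zero_succ_succ hy,
    hG.pd_zero_succ hy, zero_mul, zero_add, add_zero, sub_zero]
  have h2 : (if b = a then deriv q (y 0) / q (y 0) else 0) =
      deriv q (y 0) / q (y 0) * if b = a then 1 else 0 := by split_ifs <;> simp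
  rw [h2, ← h, Finset.mul_sum, Finset.mul_sum]
  refine Finset.sum_congr rfl fun c _ => ?_
  rw [hG.H_symm y hy a c]
  field_simp

/-- The inverse metric is block diagonal and the factors $q^{-2}$ and $q^2$ cancel, so these symbols
do not depend on time. -/
lemma christoffel_succ_succ_succ (hG : IsWarped G U q H) (hy : y ∈ U) (a b c : Fin k) :
    christoffel G c.succ a.succ b.succ y = christoffel H c a b (spatial k y) := by
  have hq := hG.q_ne_zero y hy
  rw [christoffel, Fin.sum_univ_succ, christoffel]
  simp only [hG.inv_succ_zero hy, hG.inv_succ_succ hy, hG.pd_succ_succ_succ hy, zero_mul,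
    zero_add]
  congr 1
  refine Finset.sum_congr rfl fun d _ => ?_
  field_simp

/-- The `(t, t)` component of the Ricci tensor of a warped product. -/
lemma ricci_zero_zero (hG : IsWarped G U q H) (hy : y ∈ U) {ψ' : ℝ}
    (hψ : HasDerivAt (fun t => deriv q t / q t) ψ' (y 0)) :
    ricci G 0 0 y = -(k * (ψ' + (deriv q (y 0) / q (y 0)) ^ 2)) := by
  have h1 : ∀ l, pd l (christoffel G l 0 0) y = 0 := fun l => by
    rw [pd_congr hG.isOpen (fun z hz => hG.christoffel_zero_zero hz l) hy, pd_const]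
  have h2 : ∀ a : Fin k, pd 0 (christoffel G a.succ 0 a.succ) y = ψ' := fun a => by
    rw [pd_congr hG.isOpen (fun z hz => hG.christoffel_succ_zero_succ hz a a) hy]
    simpa using pd_zero_time hψ
  -- With $\psi=q'/q$, the surviving terms are $-\sum_a\partial_t\Gamma^a_{ta}=-k\psi'$ and
  -- $-\sum_{a,b}\Gamma^a_{tb}\Gamma^b_{ta}=-k\psi^2$.
  rw [ricci]
  simp only [h1, Fin.sum_univ_succ, h2, hG.christoffel_zero_zero hy,
    hG.christoffel_zero_zero_succ hy, hG.christoffel_succ_zero_succ hy]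
  simp
  ring

/-- The mixed components of the Ricci tensor of a warped product vanish. -/
lemma ricci_succ_zero (hG : IsWarped G U q H) (hy : y ∈ U) (a : Fin k) {ψ' : ℝ}
    (hψ : HasDerivAt (fun t => deriv q t / q t) ψ' (y 0)) :
    ricci G a.succ 0 y = 0 := by
  have h0 : ∀ l, ∀ z ∈ U, christoffel G l a.succ 0 z = christoffel G l 0 a.succ z :=
    fun l z hz => hG.christoffel_symm hz _ _ _
  have h1 : pd 0 (christoffel G 0 a.succ 0) y = 0 := by
    rw [pd_congr hG.isOpen (fun z hz => (h0 0 z hz).trans (hG.christoffel_zero_zero_succ hz a)) hy,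
      pd_const]
  have h2 : ∀ b : Fin k, pd b.succ (christoffel G b.succ a.succ 0) y = 0 := fun b => by
    rw [pd_congr hG.isOpen
      (fun z hz => (h0 b.succ z hz).trans (hG.christoffel_succ_zero_succ hz a b)) hy]
    split_ifs with h
    · exact pd_succ_time b hψ
    · exact pd_const _ _ _
  have h3 : ∀ b : Fin k, pd 0 (christoffel G b.succ a.succ b.succ) y = 0 := fun b => by
    rw [pd_congr hG.isOpen (fun z hz => hG.christoffel_succ_succ_succ hz a b b) hy,
      pd_zero_comp_spatial]
  have h6 : ∀ b, christoffel H b a b (spatial k y) = christoffel H b b a (spatial k y) := fun b => by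
    rw [← hG.christoffel_succ_succ_succ hy, hG.christoffel_symm hy,
      hG.christoffel_succ_succ_succ hy]
  have h4 : ∀ b : Fin k, christoffel G 0 b.succ 0 y = 0 := fun b => by
    rw [hG.christoffel_symm hy, hG.christoffel_zero_zero_succ hy]
  have h5 : ∀ b c : Fin k, christoffel G c.succ b.succ 0 y =
      if c = b then deriv q (y 0) / q (y 0) else 0 := fun b c => by
    rw [hG.christoffel_symm hy, hG.christoffel_succ_zero_succ hy]
  -- All derivative terms vanish; the quadratic terms leave
  -- $\psi\sum_b(\Gamma^b_{ba}-\Gamma^b_{ab})$, which is zero by `h6`.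
  rw [ricci]
  simp only [Fin.sum_univ_succ, h1, h2, h3, h4, h5, hG.christoffel_zero_zero hy,
    hG.christoffel_zero_zero_succ hy, hG.christoffel_succ_zero_succ hy,
    hG.christoffel_succ_succ_succ hy]
  simp [mul_comm, h6]

end IsWarped

end Coord

/-! ### Charts of $M$ adapted to the splitting $I\times N$. -/

lemma hasMFDerivAt_opens_val {U : TopologicalSpace.Opens ℝ} (p : U) :
    HasMFDerivAt 𝓘(ℝ, ℝ) 𝓘(ℝ, ℝ) (Subtype.val : U → ℝ) p (ContinuousLinearMap.id ℝ ℝ) := by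
  refine ⟨continuous_subtype_val.continuousAt, ?_⟩
  have h : (writtenInExtChartAt 𝓘(ℝ, ℝ) 𝓘(ℝ, ℝ) p (Subtype.val : U → ℝ)) =ᶠ[nhdsWithin
      (extChartAt 𝓘(ℝ, ℝ) p p) (Set.range 𝓘(ℝ, ℝ))] id := by
    have h1 := extChartAt_target_mem_nhds (I := 𝓘(ℝ, ℝ)) p
    filter_upwards [mem_nhdsWithin_of_mem_nhds h1] with z hz
    have := (extChartAt 𝓘(ℝ, ℝ) p).right_inv hz
    simpa [writtenInExtChartAt, TopologicalSpace.Opens.chartAt_eq] using this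
  refine (hasFDerivWithinAt_id _ _).congr_of_eventuallyEq h ?_
  exact h.self_of_nhdsWithin (by simp)

/-- The identification of `ℝ × ℝᵏ` with `ℝᵏ⁺¹`. -/
def timeSpaceEquiv (k : ℕ) :
    (ℝ × EuclideanSpace ℝ (Fin k)) ≃L[ℝ] EuclideanSpace ℝ (Fin (k + 1)) :=
  (((ContinuousLinearEquiv.refl ℝ ℝ).prodCongr (EuclideanSpace.equiv (Fin k) ℝ)).trans
    (Fin.consEquivL ℝ (fun _ : Fin (k + 1) => ℝ))).trans (EuclideanSpace.equiv (Fin (k + 1)) ℝ).symm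

lemma timeSpaceEquiv_symm_apply {k : ℕ} (y : EuclideanSpace ℝ (Fin (k + 1))) :
    (timeSpaceEquiv k).symm y = (y 0, Coord.spatial k y) := rfl

namespace GRWPresentation

variable {k : ℕ} {M : Type*} [TopologicalSpace M]
  [ChartedSpace (EuclideanSpace ℝ (Fin (k + 1))) M] [IsManifold (𝓡 (k + 1)) ∞ M]
  {g : LorentzianMetric (k + 1) M}
  {N : Type*} [TopologicalSpace N] [ChartedSpace (EuclideanSpace ℝ (Fin k)) N]
  [IsManifold (𝓡 k) ∞ N]

/-- The chart of `M` around `x` given by the time coordinate and a chart of the fibre. -/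
def productChart (P : GRWPresentation g N) (x : M) :
    OpenPartialHomeomorph M (EuclideanSpace ℝ (Fin (k + 1))) :=
  P.Φ.toHomeomorph.toOpenPartialHomeomorph ≫ₕ
    ((P.I.openPartialHomeomorphSubtypeCoe ⟨(P.Φ x).1⟩).prod
      (chartAt (EuclideanSpace ℝ (Fin k)) (P.Φ x).2)) ≫ₕ
    (timeSpaceEquiv k).toHomeomorph.toOpenPartialHomeomorph

lemma mem_productChart_source (P : GRWPresentation g N) (x : M) :
    x ∈ (P.productChart x).source := by
  simp [productChart]

lemma mem_productChart_target (P : GRWPresentation g N) (x : M)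
    {y : EuclideanSpace ℝ (Fin (k + 1))} :
    y ∈ (P.productChart x).target ↔ y 0 ∈ P.I ∧
      Coord.spatial k y ∈ (chartAt (EuclideanSpace ℝ (Fin k)) (P.Φ x).2).target := by
  simp [productChart, timeSpaceEquiv_symm_apply]

lemma time_productChart_symm (P : GRWPresentation g N) (x : M)
    {y : EuclideanSpace ℝ (Fin (k + 1))} (hy : y ∈ (P.productChart x).target) :
    ((P.Φ ((P.productChart x).symm y)).1 : ℝ) = y 0 := by
  have h := ((P.mem_productChart_target x).1 hy).1
  have h2 := (P.I.openPartialHomeomorphSubtypeCoe ⟨(P.Φ x).1⟩).right_inv (x := y 0) (by simpa using h)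
  simpa [productChart, timeSpaceEquiv_symm_apply] using h2

lemma space_productChart_symm (P : GRWPresentation g N) (x : M)
    (y : EuclideanSpace ℝ (Fin (k + 1))) :
    (P.Φ ((P.productChart x).symm y)).2 =
      (chartAt (EuclideanSpace ℝ (Fin k)) (P.Φ x).2).symm (Coord.spatial k y) := by
  simp [productChart, timeSpaceEquiv_symm_apply]

lemma contMDiff_time (P : GRWPresentation g N) :
    ContMDiff (𝓡 (k + 1)) 𝓘(ℝ, ℝ) ∞ (fun z ↦ ((P.Φ z).1 : ℝ)) :=
  contMDiff_subtype_val.comp (contMDiff_fst.comp P.Φ.contMDiff)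

lemma contMDiff_space (P : GRWPresentation g N) :
    ContMDiff (𝓡 (k + 1)) (𝓡 k) ∞ (fun z ↦ (P.Φ z).2) :=
  contMDiff_snd.comp P.Φ.contMDiff

/-- The soliton equation is available in charts of the smooth atlas; membership allows it to be read
in time-space coordinates. -/
lemma productChart_mem_maximalAtlas (P : GRWPresentation g N) (x : M) :
    P.productChart x ∈ IsManifold.maximalAtlas (𝓡 (k + 1)) ∞ M := by
  apply OpenPartialHomeomorph.mem_maximalAtlas_of_contMDiffOn
  · have h : ContMDiffOn (𝓡 (k + 1)) 𝓘(ℝ, ℝ × EuclideanSpace ℝ (Fin k)) ∞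
        (fun z ↦ (((P.Φ z).1 : ℝ), chartAt (EuclideanSpace ℝ (Fin k)) (P.Φ x).2 (P.Φ z).2))
        (P.productChart x).source := by
      refine P.contMDiff_time.contMDiffOn.prodMk_space
        (contMDiffOn_chart.comp P.contMDiff_space.contMDiffOn ?_)
      intro z hz
      simpa [productChart] using hz
    exact (timeSpaceEquiv k).contDiff.contMDiff.comp_contMDiffOn h
  · refine ((P.Φ.symm.contMDiff.comp_contMDiffOn (s := (P.productChart x).target) (?_ :
      ContMDiffOn (𝓡 (k + 1)) (𝓘(ℝ, ℝ).prod (𝓡 k)) ∞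
        (fun y ↦ P.Φ ((P.productChart x).symm y)) _))).congr fun y _ => by simp
    refine ContMDiffOn.prodMk ?_ ?_
    · intro y hy
      -- Smoothness into the open set $I$ is tested after inclusion in $\mathbb R$, where the map is
      -- the coordinate $y_0$.
      rw [← ContMDiffWithinAt.subtypeVal_comp_iff]
      have h : ContMDiffWithinAt (𝓡 (k + 1)) 𝓘(ℝ, ℝ) ∞
          (fun y : EuclideanSpace ℝ (Fin (k + 1)) => y 0) (P.productChart x).target y :=
        ((EuclideanSpace.proj (𝕜 := ℝ) (0 : Fin (k + 1))).contDiff.contMDiff y).contMDiffWithinAt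
      exact h.congr (fun z hz => P.time_productChart_symm x hz) (P.time_productChart_symm x hy)
    · refine (contMDiffOn_chart_symm.comp
        (Coord.spatial k).contDiff.contMDiff.contMDiffOn fun y hy => ?_).congr
        fun y _ => P.space_productChart_symm x y
      exact ((P.mem_productChart_target x).1 hy).2

end GRWPresentation

/-! ### Coordinate vectors of a general chart. -/

section Chart

variable {n : ℕ} {M : Type*} [TopologicalSpace M]
  [ChartedSpace (EuclideanSpace ℝ (Fin n)) M] [IsManifold (𝓡 n) ∞ M]
  {e : OpenPartialHomeomorph M (EuclideanSpace ℝ (Fin n))}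

omit [IsManifold (𝓡 n) ∞ M] in
lemma OpenPartialHomeomorph.mdifferentiable_of_mem_maximalAtlas
    (he : e ∈ IsManifold.maximalAtlas (𝓡 n) ∞ M) : e.MDifferentiable (𝓡 n) (𝓡 n) :=
  ⟨(contMDiffOn_of_mem_maximalAtlas he).mdifferentiableOn (by simp),
    (contMDiffOn_symm_of_mem_maximalAtlas he).mdifferentiableOn (by simp)⟩

omit [IsManifold (𝓡 n) ∞ M] in
lemma mdifferentiableAt_chart_symm (he : e ∈ IsManifold.maximalAtlas (𝓡 n) ∞ M)
    {y : EuclideanSpace ℝ (Fin n)} (hy : y ∈ e.target) :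
    MDifferentiableAt (𝓡 n) (𝓡 n) e.symm y :=
  (OpenPartialHomeomorph.mdifferentiable_of_mem_maximalAtlas he).mdifferentiableAt_symm hy

lemma dirDeriv_coordVec (he : e ∈ IsManifold.maximalAtlas (𝓡 n) ∞ M)
    {y : EuclideanSpace ℝ (Fin n)} (hy : y ∈ e.target) {u : M → ℝ}
    (hu : MDifferentiableAt (𝓡 n) 𝓘(ℝ, ℝ) u (e.symm y)) (i : Fin n) :
    dirDeriv u (e.symm y) (LorentzianMetric.coordVec e i y) = Coord.pd i (u ∘ e.symm) y := by
  rw [dirDeriv, LorentzianMetric.coordVec, Coord.pd, ← mfderiv_eq_fderiv,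
    mfderiv_comp y hu (mdifferentiableAt_chart_symm he hy)]
  rfl

/-- Coordinate vector fields are smooth. -/
lemma contMDiffOn_coordVec (he : e ∈ IsManifold.maximalAtlas (𝓡 n) ∞ M) (i : Fin n) :
    ContMDiffOn (𝓡 n) (𝓡 n).tangent ∞ (fun y ↦ (⟨e.symm y, LorentzianMetric.coordVec e i y⟩ :
      TangentBundle (𝓡 n) M)) e.target := by
  have h1 : ContMDiff (𝓡 n) (𝓡 n).tangent ∞ (fun y : EuclideanSpace ℝ (Fin n) ↦
      (⟨y, EuclideanSpace.single i 1⟩ : TangentBundle (𝓡 n) (EuclideanSpace ℝ (Fin n)))) := by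
    exact contMDiff_vectorSpace_iff_contDiff (V := fun _ => EuclideanSpace.single i 1).2
      contDiff_const
  have h2 := (contMDiffOn_symm_of_mem_maximalAtlas he).contMDiffOn_tangentMapWithin
    (m := ∞) (by simp) e.open_target.uniqueMDiffOn
  refine (h2.comp h1.contMDiffOn fun y hy => hy).congr fun y hy => ?_
  simp only [Function.comp, tangentMapWithin, LorentzianMetric.coordVec]
  rw [mfderivWithin_of_isOpen e.open_target hy]

omit [IsManifold (𝓡 n) ∞ M] in
lemma sum_coordVec {e : OpenPartialHomeomorph M (EuclideanSpace ℝ (Fin n))}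
    (y v : EuclideanSpace ℝ (Fin n)) :
    mfderiv (𝓡 n) (𝓡 n) e.symm y v = ∑ i, v i • LorentzianMetric.coordVec e i y := by
  have hv : v = ∑ i, v i • EuclideanSpace.single i (1 : ℝ) := by
    ext j; simp [Pi.single_apply]
  conv_lhs => rw [hv]
  exact (map_sum (mfderiv (𝓡 n) (𝓡 n) e.symm y) _ _).trans
    (Finset.sum_congr rfl fun i _ => map_smul (mfderiv (𝓡 n) (𝓡 n) e.symm y) _ _)

/-- Coordinate vectors span the tangent space, so vanishing components would make the timelike
vector null. This later gives the non-vanishing of $S=\beta g$. -/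
lemma LorentzianMetric.comp_ne_zero (g : LorentzianMetric n M)
    (he : e ∈ IsManifold.maximalAtlas (𝓡 n) ∞ M) {y : EuclideanSpace ℝ (Fin n)}
    (hy : y ∈ e.target) : ∃ i j, g.comp e y i j ≠ 0 := by
  by_contra! h
  obtain ⟨v, hv, -⟩ := g.signature (e.symm y)
  obtain ⟨w, rfl⟩ :=
    (OpenPartialHomeomorph.mdifferentiable_of_mem_maximalAtlas he).symm.mfderiv_surjective hy v
  rw [sum_coordVec (e := e) y w] at hv
  refine hv.ne ?_
  simp only [map_sum, map_smul, sum_apply, smul_apply,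
    smul_eq_mul]
  refine Finset.sum_eq_zero fun j _ => mul_eq_zero_of_right _ (Finset.sum_eq_zero fun i _ => ?_)
  rw [show g.inner (e.symm y) (coordVec e i y) (coordVec e j y) = 0 from h i j, mul_zero]

end Chart

/-! ### The differential of $\Phi$ and the field $\rho$ in a product chart. -/

namespace GRWPresentation

variable {k : ℕ} {M : Type*} [TopologicalSpace M]
  [ChartedSpace (EuclideanSpace ℝ (Fin (k + 1))) M] [IsManifold (𝓡 (k + 1)) ∞ M]
  {g : LorentzianMetric (k + 1) M}
  {N : Type*} [TopologicalSpace N] [ChartedSpace (EuclideanSpace ℝ (Fin k)) N]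
  [IsManifold (𝓡 k) ∞ N]

lemma dirDeriv_time_coordVec (P : GRWPresentation g N) (x : M)
    {y : EuclideanSpace ℝ (Fin (k + 1))} (hy : y ∈ (P.productChart x).target) (i : Fin (k + 1)) :
    dirDeriv (fun z ↦ ((P.Φ z).1 : ℝ)) ((P.productChart x).symm y)
      (LorentzianMetric.coordVec (P.productChart x) i y) = if i = 0 then 1 else 0 := by
  rw [dirDeriv_coordVec (P.productChart_mem_maximalAtlas x) hy
    (P.contMDiff_time.mdifferentiableAt (by simp)),
    Coord.pd_congr (P.productChart x).open_target
      (u := (fun z ↦ ((P.Φ z).1 : ℝ)) ∘ (P.productChart x).symm)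
      (fun z hz => P.time_productChart_symm x hz) hy, Coord.pd]
  rw [show (fun z : EuclideanSpace ℝ (Fin (k + 1)) => z 0) =
    (EuclideanSpace.proj 0 : EuclideanSpace ℝ (Fin (k + 1)) →L[ℝ] ℝ) from rfl,
    ContinuousLinearMap.fderiv]
  simp [eq_comm]

lemma mfderiv_space_coordVec (P : GRWPresentation g N) (x : M)
    {y : EuclideanSpace ℝ (Fin (k + 1))} (hy : y ∈ (P.productChart x).target) (i : Fin (k + 1)) :
    (mfderiv (𝓡 (k + 1)) (𝓡 k) (fun z ↦ (P.Φ z).2) ((P.productChart x).symm y)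
      (LorentzianMetric.coordVec (P.productChart x) i y) : EuclideanSpace ℝ (Fin k)) =
    mfderiv (𝓡 k) (𝓡 k) (chartAt (EuclideanSpace ℝ (Fin k)) (P.Φ x).2).symm (Coord.spatial k y)
      (Coord.spatial k (EuclideanSpace.single i 1)) := by
  have h1 := mfderiv_comp y (P.contMDiff_space.mdifferentiableAt (by simp))
    (mdifferentiableAt_chart_symm (P.productChart_mem_maximalAtlas x) hy)
  have h2 : MDifferentiableAt (𝓡 k) (𝓡 k)
      (chartAt (EuclideanSpace ℝ (Fin k)) (P.Φ x).2).symm (Coord.spatial k y) :=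
    (mdifferentiable_chart _).mdifferentiableAt_symm ((P.mem_productChart_target x).1 hy).2
  have h3 := mfderiv_comp y h2 (Coord.spatial k).differentiableAt.mdifferentiableAt
  have h4 : (fun z ↦ (P.Φ z).2) ∘ (P.productChart x).symm =
      (chartAt (EuclideanSpace ℝ (Fin k)) (P.Φ x).2).symm ∘ Coord.spatial k :=
    funext fun z => P.space_productChart_symm x z
  rw [h4, h3] at h1
  have h5 := congrArg (fun A => A (EuclideanSpace.single i (1 : ℝ))) h1
  rw [mfderiv_eq_fderiv, ContinuousLinearMap.fderiv] at h5
  exact h5.symm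

/-- The differential of $\Phi$ sends the zeroth coordinate vector to $(1,0)$, as its time and space
parts show; since it is invertible, this vector is the pullback of $\partial_t$. -/
lemma rho_productChart_symm (P : GRWPresentation g N) (x : M)
    {y : EuclideanSpace ℝ (Fin (k + 1))} (hy : y ∈ (P.productChart x).target) :
    P.rho ((P.productChart x).symm y) = LorentzianMetric.coordVec (P.productChart x) 0 y := by
  set z := (P.productChart x).symm y
  set w := LorentzianMetric.coordVec (P.productChart x) 0 y
  have hA : mfderiv (𝓡 (k + 1)) (𝓘(ℝ, ℝ).prod (𝓡 k)) P.Φ z w = P.timeField (P.Φ z) := by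
    have h0 : MDifferentiableAt (𝓡 (k + 1)) (𝓘(ℝ, ℝ).prod (𝓡 k)) P.Φ z :=
      P.Φ.mdifferentiable (by simp) z
    have h1 := mfderiv_prodMk h0.fst h0.snd
    have h2 := P.dirDeriv_time_coordVec x hy 0
    rw [dirDeriv] at h2
    have h3 := ((hasMFDerivAt_opens_val (P.Φ z).1).comp z h0.fst.hasMFDerivAt).mfderiv
    have h4 := P.mfderiv_space_coordVec x hy 0
    rw [Coord.spatial_single_zero] at h4
    replace h4 := h4.trans (map_zero (mfderiv (𝓡 k) (𝓡 k)
      (chartAt (EuclideanSpace ℝ (Fin k)) (P.Φ x).2).symm (Coord.spatial k y)))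
    have h5 := congrArg (fun A => A w) h3
    refine (congrArg (fun A => A w) h1).trans (Prod.ext ?_ ?_)
    · refine Eq.trans ?_ (h5.symm.trans (h2.trans (if_pos rfl)))
      rfl
    · exact h4
  have hinv : (mfderiv (𝓡 (k + 1)) (𝓘(ℝ, ℝ).prod (𝓡 k)) P.Φ z).IsInvertible :=
    ⟨P.Φ.mfderivToContinuousLinearEquiv (by simp) z, rfl⟩
  rw [rho, VectorField.mpullback_apply, ← hA]
  exact hinv.inverse_apply_eq.2 rfl

end GRWPresentation

/-- The components of a Riemannian metric in a chart. -/
def Bundle.ContMDiffRiemannianMetric.comp {k : ℕ} {N : Type*} [TopologicalSpace N]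
    [ChartedSpace (EuclideanSpace ℝ (Fin k)) N] [IsManifold (𝓡 k) ∞ N]
    (h : Bundle.ContMDiffRiemannianMetric (𝓡 k) ∞ (EuclideanSpace ℝ (Fin k))
      (fun p : N ↦ TangentSpace (𝓡 k) p))
    (φ : OpenPartialHomeomorph N (EuclideanSpace ℝ (Fin k))) (p : EuclideanSpace ℝ (Fin k)) :
    Matrix (Fin k) (Fin k) ℝ :=
  Matrix.of fun a b => h.inner (φ.symm p) (LorentzianMetric.coordVec φ a p)
    (LorentzianMetric.coordVec φ b p)

/-! ### Non-degeneracy and regularity of the fibre metric in coordinates. -/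

namespace Bundle.ContMDiffRiemannianMetric

variable {k : ℕ} {N : Type*} [TopologicalSpace N]
    [ChartedSpace (EuclideanSpace ℝ (Fin k)) N] [IsManifold (𝓡 k) ∞ N]
    (h : Bundle.ContMDiffRiemannianMetric (𝓡 k) ∞ (EuclideanSpace ℝ (Fin k))
      (fun p : N ↦ TangentSpace (𝓡 k) p))
    {φ : OpenPartialHomeomorph N (EuclideanSpace ℝ (Fin k))}

lemma comp_symm (p : EuclideanSpace ℝ (Fin k)) (a b : Fin k) :
    h.comp φ p a b = h.comp φ p b a := h.symm _ _ _

/-- A kernel vector of the component matrix would represent a non-zero tangent vector of zero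
length, contradicting positivity. -/
lemma isUnit_det_comp (hφ : φ ∈ IsManifold.maximalAtlas (𝓡 k) ∞ N)
    {p : EuclideanSpace ℝ (Fin k)} (hp : p ∈ φ.target) : IsUnit (h.comp φ p).det := by
  rw [isUnit_iff_ne_zero]
  intro h0
  obtain ⟨v, hv, hv0⟩ := Matrix.exists_mulVec_eq_zero_iff.2 h0
  set V : EuclideanSpace ℝ (Fin k) := WithLp.toLp 2 v
  have hinj := (OpenPartialHomeomorph.mdifferentiable_of_mem_maximalAtlas
    hφ).symm.mfderiv_injective hp
  have hne : mfderiv (𝓡 k) (𝓡 k) φ.symm p V ≠ 0 := fun h1 => by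
    refine hv ?_
    have h2 : V = 0 := hinj (h1.trans (map_zero _).symm)
    ext i
    exact congrArg (fun w : EuclideanSpace ℝ (Fin k) => w i) h2
  have hpos := h.pos _ _ hne
  rw [sum_coordVec (e := φ) p V] at hpos
  refine hpos.ne' ?_
  simp only [map_sum, map_smul, sum_apply, smul_apply, smul_eq_mul]
  refine Finset.sum_eq_zero fun a _ => mul_eq_zero_of_right _
    ((Finset.sum_congr rfl fun b _ => ?_).trans (congrFun hv0 a))
  rw [mul_comm, h.symm]
  rfl

lemma differentiableAt_comp (hφ : φ ∈ IsManifold.maximalAtlas (𝓡 k) ∞ N)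
    {p : EuclideanSpace ℝ (Fin k)} (hp : p ∈ φ.target) (a b : Fin k) :
    DifferentiableAt ℝ (fun z => h.comp φ z a b) p := by
  have h1 := h.contMDiff.comp_contMDiffOn (contMDiffOn_symm_of_mem_maximalAtlas hφ)
  have h2 := ContMDiffOn.clm_bundle_apply₂ (F₁ := EuclideanSpace ℝ (Fin k))
    (F₂ := EuclideanSpace ℝ (Fin k)) (F₃ := ℝ) (E₁ := fun p : N ↦ TangentSpace (𝓡 k) p)
    (E₂ := fun p : N ↦ TangentSpace (𝓡 k) p) (E₃ := Bundle.Trivial N ℝ) (b := φ.symm)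
    h1 (contMDiffOn_coordVec hφ a) (contMDiffOn_coordVec hφ b)
  have h3 := (h2 p hp).contMDiffAt (φ.open_target.mem_nhds hp)
  rw [Bundle.contMDiffAt_totalSpace] at h3
  have h4 := (contMDiffAt_iff_contDiffAt.1 h3.2).differentiableAt (by simp)
  exact h4

end Bundle.ContMDiffRiemannianMetric

/-! ### The metric, $\psi$, $\mu$ and $\rho$ in product coordinates. -/

namespace GRWPresentation

variable {k : ℕ} {M : Type*} [TopologicalSpace M]
  [ChartedSpace (EuclideanSpace ℝ (Fin (k + 1))) M] [IsManifold (𝓡 (k + 1)) ∞ M]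
  {g : LorentzianMetric (k + 1) M}
  {N : Type*} [TopologicalSpace N] [ChartedSpace (EuclideanSpace ℝ (Fin k)) N]
  [IsManifold (𝓡 k) ∞ N]

lemma contDiffAt_q (P : GRWPresentation g N) {t : ℝ} (ht : t ∈ P.I) : ContDiffAt ℝ ∞ P.q t :=
  P.q_smooth.contDiffAt (P.I.isOpen.mem_nhds ht)

lemma hasDerivAt_psi (P : GRWPresentation g N) {t : ℝ} (ht : t ∈ P.I) :
    HasDerivAt (fun t => deriv P.q t / P.q t) (deriv (fun t => deriv P.q t / P.q t) t) t := by
  have h1 : ContDiffAt ℝ ∞ (deriv P.q) t := (P.contDiffAt_q ht).derivWithin (by simp)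
  exact ((h1.differentiableAt (by simp)).div ((P.contDiffAt_q ht).differentiableAt (by simp))
    (P.q_pos t ht).ne').hasDerivAt

lemma comp_productChart (P : GRWPresentation g N) (x : M)
    {y : EuclideanSpace ℝ (Fin (k + 1))} (hy : y ∈ (P.productChart x).target)
    (i j : Fin (k + 1)) :
    g.comp (P.productChart x) y i j = -((if i = 0 then 1 else 0) * if j = 0 then 1 else 0) +
      P.q (y 0) ^ 2 * P.h.inner
        ((chartAt (EuclideanSpace ℝ (Fin k)) (P.Φ x).2).symm (Coord.spatial k y))
        (mfderiv (𝓡 k) (𝓡 k) (chartAt (EuclideanSpace ℝ (Fin k)) (P.Φ x).2).symm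
          (Coord.spatial k y) (Coord.spatial k (EuclideanSpace.single i 1)))
        (mfderiv (𝓡 k) (𝓡 k) (chartAt (EuclideanSpace ℝ (Fin k)) (P.Φ x).2).symm
          (Coord.spatial k y) (Coord.spatial k (EuclideanSpace.single j 1))) := by
  -- The base points are equal but not by definition; viewing tangent vectors in the common model
  -- space permits the rewriting.
  have key : ∀ (p p' : N) (v w v' w' : EuclideanSpace ℝ (Fin k)), p = p' → v = v' → w = w' →
      P.h.inner p v w = P.h.inner p' v' w' := by
    rintro p _ v w _ _ rfl rfl rfl; rfl
  refine (P.isometry _ _ _).trans ?_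
  rw [P.dirDeriv_time_coordVec x hy i, P.dirDeriv_time_coordVec x hy j,
    P.time_productChart_symm x hy]
  congr 2
  exact key _ _ _ _ _ _ (P.space_productChart_symm x y) (P.mfderiv_space_coordVec x hy i)
    (P.mfderiv_space_coordVec x hy j)

lemma isWarped_productChart (P : GRWPresentation g N) (x : M) :
    Coord.IsWarped (g.comp (P.productChart x)) (P.productChart x).target P.q
      (P.h.comp (chartAt (EuclideanSpace ℝ (Fin k)) (P.Φ x).2)) := by
  have hmem : ∀ y ∈ (P.productChart x).target, _ := fun y hy => (P.mem_productChart_target x).1 hy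
  have map_zero_left : ∀ (B : EuclideanSpace ℝ (Fin k) →L[ℝ] EuclideanSpace ℝ (Fin k) →L[ℝ] ℝ)
      (D : EuclideanSpace ℝ (Fin k) →L[ℝ] EuclideanSpace ℝ (Fin k)) (v : EuclideanSpace ℝ (Fin k)),
      B (D 0) v = 0 := by simp
  have map_zero_right : ∀ (B : EuclideanSpace ℝ (Fin k) →L[ℝ] EuclideanSpace ℝ (Fin k) →L[ℝ] ℝ)
      (D : EuclideanSpace ℝ (Fin k) →L[ℝ] EuclideanSpace ℝ (Fin k)) (v : EuclideanSpace ℝ (Fin k)),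
      B v (D 0) = 0 := by simp
  have hφ := IsManifold.chart_mem_maximalAtlas (I := 𝓡 k) (n := ∞) (P.Φ x).2
  refine ⟨(P.productChart x).open_target, fun y hy => (P.q_pos _ (hmem y hy).1).ne',
    fun y hy => (P.contDiffAt_q (hmem y hy).1).differentiableAt (by simp),
    fun y _ a b => P.h.comp_symm _ a b, fun y hy => P.h.isUnit_det_comp hφ (hmem y hy).2,
    fun y hy a b => P.h.differentiableAt_comp hφ (hmem y hy).2 a b, fun y hy => ?_,
    fun y hy a => ?_, fun y hy a => ?_, fun y hy a b => ?_⟩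
  · rw [P.comp_productChart x hy, Coord.spatial_single_zero]
    exact (congrArg (HAdd.hAdd _) (mul_eq_zero_of_right _ (map_zero_left _ _ _))).trans (by simp)
  · rw [P.comp_productChart x hy, Coord.spatial_single_zero]
    exact (congrArg (HAdd.hAdd _) (mul_eq_zero_of_right _ (map_zero_left _ _ _))).trans (by simp)
  · rw [P.comp_productChart x hy, Coord.spatial_single_zero]
    exact (congrArg (HAdd.hAdd _) (mul_eq_zero_of_right _ (map_zero_right _ _ _))).trans (by simp)
  · rw [P.comp_productChart x hy, Coord.spatial_single_succ, Coord.spatial_single_succ]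
    simp only [Fin.succ_ne_zero, if_false, mul_zero, neg_zero, zero_add]
    rfl

lemma rhoDeriv_productChart_symm (P : GRWPresentation g N) (x : M)
    {y : EuclideanSpace ℝ (Fin (k + 1))} (hy : y ∈ (P.productChart x).target) {u : M → ℝ}
    (hu : MDifferentiableAt (𝓡 (k + 1)) 𝓘(ℝ, ℝ) u ((P.productChart x).symm y)) :
    P.rhoDeriv u ((P.productChart x).symm y) = Coord.pd 0 (u ∘ (P.productChart x).symm) y := by
  rw [rhoDeriv, P.rho_productChart_symm x hy,
    dirDeriv_coordVec (P.productChart_mem_maximalAtlas x) hy hu]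

/-- In a product chart $\rho$ is $\partial_0$ and the function depends on $y_0$ alone. This turns
$\psi$ and $\mu$ into ordinary derivatives of $q$. -/
lemma rhoDeriv_comp_time (P : GRWPresentation g N) (x : M) {u : ℝ → ℝ} {u' : ℝ}
    (hu : HasDerivAt u u' (P.Φ x).1) : P.rhoDeriv (fun z => u (P.Φ z).1) x = u' := by
  have hx := P.mem_productChart_source x
  have hy := (P.productChart x).map_source hx
  have hinv := (P.productChart x).left_inv hx
  have h1 : MDifferentiableAt (𝓡 (k + 1)) 𝓘(ℝ, ℝ) (fun z => u (P.Φ z).1) x :=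
    (hu.differentiableAt.mdifferentiableAt).comp x (P.contMDiff_time.mdifferentiableAt (by simp))
  have h2 := P.rhoDeriv_productChart_symm x hy (u := fun z => u (P.Φ z).1) (by rwa [hinv])
  rw [hinv] at h2
  rw [h2, Coord.pd_congr (P.productChart x).open_target
    (u := (fun z => u (P.Φ z).1) ∘ (P.productChart x).symm) (v := fun z => u (z 0))
    (fun z hz => congrArg u (P.time_productChart_symm x hz)) hy]
  refine Coord.pd_zero_time ?_
  rwa [← P.time_productChart_symm x hy, hinv]

lemma psi_eq (P : GRWPresentation g N) (x : M) :
    P.psi x = deriv P.q (P.Φ x).1 / P.q (P.Φ x).1 := by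
  rw [psi, P.rhoDeriv_comp_time x
    ((P.contDiffAt_q (P.Φ x).1.2).differentiableAt (by simp)).hasDerivAt]

lemma mu_eq (P : GRWPresentation g N) (x : M) :
    P.mu x = deriv (fun t => deriv P.q t / P.q t) (P.Φ x).1 +
      (deriv P.q (P.Φ x).1 / P.q (P.Φ x).1) ^ 2 := by
  rw [mu, P.psi_eq x, funext P.psi_eq, P.rhoDeriv_comp_time x (P.hasDerivAt_psi (P.Φ x).1.2)]

lemma unit_rho (P : GRWPresentation g N) (x : M) : g.inner x (P.rho x) (P.rho x) = -1 := by
  have hx := P.mem_productChart_source x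
  have hy := (P.productChart x).map_source hx
  have h := (P.isWarped_productChart x).zero_zero _ hy
  have h2 : g.inner _ (P.rho ((P.productChart x).symm (P.productChart x x))) (P.rho _) = -1 := by
    rw [P.rho_productChart_symm x hy]; exact h
  rwa [(P.productChart x).left_inv hx] at h2

lemma contMDiff_rho (P : GRWPresentation g N) :
    ContMDiff (𝓡 (k + 1)) (𝓡 (k + 1)).tangent ∞
      (fun x ↦ (⟨x, P.rho x⟩ : TangentBundle (𝓡 (k + 1)) M)) := by
  intro x
  have hx := P.mem_productChart_source x
  have he := P.productChart_mem_maximalAtlas x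
  have h1 := (contMDiffOn_coordVec he 0).comp (contMDiffOn_of_mem_maximalAtlas he)
    fun z hz => (P.productChart x).map_source hz
  refine ((h1 x hx).contMDiffAt ((P.productChart x).open_source.mem_nhds hx)).congr_of_eventuallyEq
    (Filter.eventuallyEq_of_mem ((P.productChart x).open_source.mem_nhds hx) fun z hz => ?_)
  simp only [Function.comp]
  rw [← P.rho_productChart_symm x ((P.productChart x).map_source hz),
    (P.productChart x).left_inv hz]

end GRWPresentation

/-! ### Vanishing of $df$. -/

namespace GRWPresentation

variable {k : ℕ} {M : Type*} [TopologicalSpace M]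
  [ChartedSpace (EuclideanSpace ℝ (Fin (k + 1))) M] [IsManifold (𝓡 (k + 1)) ∞ M]
  {g : LorentzianMetric (k + 1) M}
  {N : Type*} [TopologicalSpace N] [ChartedSpace (EuclideanSpace ℝ (Fin k)) N]
  [IsManifold (𝓡 k) ∞ N]

/-- In a product chart, all partial derivatives of the potential function vanish. -/
lemma pd_potential_eq_zero (P : GRWPresentation g N) {f : M → ℝ} {m lam τ : ℝ}
    (hsol : g.IsQuasiEinsteinSoliton f m lam τ) {β : ℝ} (hβ0 : β ≠ 0)
    (hβ : ∀ x, lam + τ * g.scalarCurvature x = β) (hμ : ∀ x, k * P.mu x = β)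
    {c : ℝ} (hf : ∀ x, P.rhoDeriv f x = c) (x : M)
    {y : EuclideanSpace ℝ (Fin (k + 1))} (hy : y ∈ (P.productChart x).target)
    (i : Fin (k + 1)) : Coord.pd i (f ∘ (P.productChart x).symm) y = 0 := by
  have he := P.productChart_mem_maximalAtlas x
  have hW := P.isWarped_productChart x
  set e := P.productChart x
  set F := f ∘ e.symm
  have hFs : ContDiffOn ℝ ∞ F e.target := contMDiffOn_iff_contDiffOn.1
    (hsol.smooth.comp_contMDiffOn (contMDiffOn_symm_of_mem_maximalAtlas he))
  have h0 : ∀ z ∈ e.target, Coord.pd 0 F z = c := fun z hz => by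
    rw [← P.rhoDeriv_productChart_symm x hz (hsol.smooth.mdifferentiableAt (by simp)), hf]
  have hI : ∀ z ∈ e.target, z 0 ∈ P.I := fun z hz => ((P.mem_productChart_target x).1 hz).1
  have hψ := fun z (hz : z ∈ e.target) => P.hasDerivAt_psi (hI z hz)
  have hμ' : ∀ z ∈ e.target, k * (deriv (fun t => deriv P.q t / P.q t) (z 0) +
      (deriv P.q (z 0) / P.q (z 0)) ^ 2) = β := fun z hz => by
    rw [← hμ (e.symm z), P.mu_eq, P.time_productChart_symm x hz]
  have hpp : ∀ j, ∀ z ∈ e.target, Coord.pd j (Coord.pd 0 F) z = 0 := fun j z hz => by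
    rw [Coord.pd_congr e.open_target h0 hz, Coord.pd_const]
  -- The $(t,t)$ equation: the Hessian term is $0$, since $\partial_t f$ is constant and
  -- $\Gamma^l_{tt}=0$, and $S_{tt}=-\beta=\beta g_{tt}$, leaving $c^2/m=0$.
  have hc : c = 0 := by
    have h := hsol.eqn e he y hy 0 0
    rw [LorentzianMetric.hess, Coord.hess, LorentzianMetric.ricci, hβ, hpp 0 y hy,
      hW.ricci_zero_zero hy (hψ y hy), hμ' y hy, h0 y hy, hW.zero_zero y hy] at h
    simp only [hW.christoffel_zero_zero hy, zero_mul, Finset.sum_const_zero] at h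
    have hm := hsol.pos.ne'
    have h2 : 1 / m * (c * c) = 0 := by linarith
    simpa [hm] using h2
  -- The $(a,t)$ equation: $S_{at}$, $g_{at}$ and $\partial_a\partial_t f$ vanish, $c=0$ removes
  -- $df\otimes df$, and the Hessian leaves $-\psi\,\partial_a f$.
  have hmix : ∀ z ∈ e.target, ∀ a : Fin k,
      deriv P.q (z 0) / P.q (z 0) * Coord.pd a.succ F z = 0 := fun z hz a => by
    have h := hsol.eqn e he z hz a.succ 0
    rw [LorentzianMetric.hess, Coord.hess, LorentzianMetric.ricci, hβ, hpp _ z hz,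
      hW.ricci_succ_zero hz a (hψ z hz), h0 z hz, hW.succ_zero z hz, Fin.sum_univ_succ,
      hW.christoffel_symm hz, hW.christoffel_zero_zero_succ hz, hc] at h
    simp only [hW.christoffel_symm hz _ a.succ 0, hW.christoffel_succ_zero_succ hz] at h
    simpa using h
  refine Fin.cases ((h0 y hy).trans hc) (fun a => ?_) i
  by_contra hne
  -- Vanishing of $\psi$ at one point would not control $\psi'$; continuity of $\partial_a f$
  -- provides an open set on which $\psi=0$.
  have hcont : ContinuousOn (Coord.pd a.succ F) e.target :=
    (hFs.continuousOn_fderiv_of_isOpen e.open_target (by simp)).clm_apply continuousOn_const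
  have hopen := hcont.isOpen_inter_preimage e.open_target (isOpen_compl_singleton (x := (0 : ℝ)))
  have hyV : y ∈ e.target ∩ Coord.pd a.succ F ⁻¹' {0}ᶜ := ⟨hy, hne⟩
  have hzero : ∀ z ∈ e.target ∩ Coord.pd a.succ F ⁻¹' {0}ᶜ, deriv P.q (z 0) / P.q (z 0) = 0 :=
    fun z hz => (mul_eq_zero.1 (hmix z hz.1 a)).resolve_right hz.2
  have h1 := Coord.pd_zero_time (hψ y hy)
  rw [Coord.pd_congr hopen hzero hyV, Coord.pd_const] at h1
  have h2 := hμ' y hy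
  rw [← h1, hzero y hyV] at h2
  exact hβ0 (by simpa using h2.symm)

/-- The potential function has vanishing differential. -/
lemma dirDeriv_potential_eq_zero (P : GRWPresentation g N) {f : M → ℝ} {m lam τ : ℝ}
    (hsol : g.IsQuasiEinsteinSoliton f m lam τ) {β : ℝ} (hβ0 : β ≠ 0)
    (hβ : ∀ x, lam + τ * g.scalarCurvature x = β) (hμ : ∀ x, k * P.mu x = β)
    {c : ℝ} (hf : ∀ x, P.rhoDeriv f x = c) (x : M) (v : TangentSpace (𝓡 (k + 1)) x) :
    dirDeriv f x v = 0 := by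
  have he := P.productChart_mem_maximalAtlas x
  have hx := P.mem_productChart_source x
  have hy := (P.productChart x).map_source hx
  suffices h : ∀ v, dirDeriv f ((P.productChart x).symm (P.productChart x x)) v = 0 by
    rw [(P.productChart x).left_inv hx] at h
    exact h v
  intro v
  obtain ⟨w, rfl⟩ :=
    (OpenPartialHomeomorph.mdifferentiable_of_mem_maximalAtlas he).symm.mfderiv_surjective hy v
  refine (congrArg (dirDeriv f _) (sum_coordVec (e := P.productChart x) _ w)).trans ?_
  refine (map_sum (mfderiv (𝓡 (k + 1)) 𝓘(ℝ, ℝ) f _) _ _).trans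
    (Finset.sum_eq_zero fun i _ => ?_)
  refine (map_smul (mfderiv (𝓡 (k + 1)) 𝓘(ℝ, ℝ) f _) _ _).trans (smul_eq_zero_of_right _ ?_)
  exact (dirDeriv_coordVec he hy (hsol.smooth.mdifferentiableAt (by simp)) i).trans
    (P.pd_potential_eq_zero hsol hβ0 hβ hμ hf x hy i)

end GRWPresentation

end

/-! ### The Einstein equation and the conclusion. -/

theorem mainTheorem2 {k : ℕ} (hk : 4 ≤ k + 1)
    {M : Type*} [TopologicalSpace M] [ChartedSpace (EuclideanSpace ℝ (Fin (k + 1))) M]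
    [IsManifold (𝓡 (k + 1)) ∞ M]
    {N : Type*} [TopologicalSpace N] [ChartedSpace (EuclideanSpace ℝ (Fin k)) N]
    [IsManifold (𝓡 k) ∞ N]
    (g : LorentzianMetric (k + 1) M) (P : GRWPresentation g N)
    (f : M → ℝ) (m lam τ : ℝ) (hsol : g.IsQuasiEinsteinSoliton f m lam τ)
    (β : ℝ) (hβ0 : β ≠ 0)
    (hβ : ∀ x, lam + τ * g.scalarCurvature x = β)
    (hμ : ∀ x, ((k + 1 : ℝ) - 1) * P.mu x = β)
    (hf : ∃ c : ℝ, ∀ x, P.rhoDeriv f x = c) :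
    g.IsPerfectFluid P.rho := by
  obtain ⟨c, hf⟩ := hf
  have hμ' : ∀ x, k * P.mu x = β := by simpa using hμ
  -- The vanishing of $df$ is free of coordinates, so it passes from product charts to every chart
  -- of the atlas.
  have hpd : ∀ e ∈ IsManifold.maximalAtlas (𝓡 (k + 1)) ∞ M, ∀ y ∈ e.target, ∀ i,
      Coord.pd i (f ∘ e.symm) y = 0 := fun e he y hy i => by
    rw [← dirDeriv_coordVec he hy (hsol.smooth.mdifferentiableAt (by simp)),
      P.dirDeriv_potential_eq_zero hsol hβ0 hβ hμ' hf]
  have hE : ∀ e ∈ IsManifold.maximalAtlas (𝓡 (k + 1)) ∞ M, ∀ y ∈ e.target, ∀ i j,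
      g.ricci e i j y = β * g.comp e y i j := fun e he y hy i j => by
    have h := hsol.eqn e he y hy i j
    rw [hβ, LorentzianMetric.hess, Coord.hess,
      Coord.pd_congr e.open_target (fun z hz => hpd e he z hz j) hy, Coord.pd_const] at h
    simpa [hpd e he y hy] using h
  refine ⟨P.contMDiff_rho, P.unit_rho, fun e he y hy => ?_, fun _ => β, fun _ => 0,
    contMDiff_const, contMDiff_const, fun e he y hy i j => by rw [hE e he y hy i j]; ring⟩
  obtain ⟨i, j, hij⟩ := g.comp_ne_zero he hy
  exact ⟨i, j, by rw [hE e he y hy i j]; exact mul_ne_zero hβ0 hij⟩
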